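/- Proposition 2. Let $M$ be a smooth manifold of odd dimension $n=2m+1$ with a sub-Riemannian structure of contact type $(\vec\xi,\eta,g,D)$: $g$ is a smooth Riemannian metric on $M$, $\vec\xi$ is a smooth vector field with $g(\vec\xi,\vec\xi)=1$, $\eta$ is a smooth $1$-form with $\eta(\vec\xi)=1$, and the distribution $D=\ker\eta$ is orthogonal to $\vec\xi$. Let $\widetilde\nabla$ be the Levi-Civita connection of $g$, and let $\omega=d\eta$, normalized by $2\,d\eta(X,Y)=X\eta(Y)-Y\eta(X)-\eta([X,Y])$. Let $\psi$ and $C$ be the endomorphisms of $TM$ that kill $\vec\xi$, map $D$ to $D$, and satisfy $$g(\psi X,Y)=\omega(X,Y),\qquad g(CX,Y)=\tfrac12 (L_{\vec\xi}\,g)(X,Y)\qquad\text{for } X,Y\in D.$$ Let $N$ be a smooth endomorphism of $TM$ with $N\vec\xi=0$ and $N(D)\subset D$, and let $\nabla^N$ be the linear connection $$\nabla^N_XY=\widetilde\nabla_XY+(\widetilde\nabla_X\eta)(Y)\,\vec\xi-\eta(Y)\widetilde\nabla_X\vec\xi-\eta(X)(\widetilde\nabla_{\vec\xi}\,\eta)(Y)\,\vec\xi-\eta(X)(C+\psi-N)Y.$$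 Let $S(X,Y)=\nabla^N_XY-\nabla^N_YX-[X,Y]$ be its torsion. Then $\tilde S(X,Y,Z)=g(S(X,Y),Z)$ is skew-symmetric in all its arguments if and only if $N=2\psi$. -/

import Mathlib

open Bundle FiberBundle VectorField
open scoped Manifold ContDiff

noncomputable section

namespace SubRiem

variable {E : Type*} [NormedAddCommGroup E] [NormedSpace ℝ E]
  {H : Type*} [TopologicalSpace H] {I : ModelWithCorners ℝ E H}
  {M : Type*} [TopologicalSpace M] [ChartedSpace H M] [IsManifold I ∞ M]

set_option linter.unusedSectionVars false

/-! ### Smooth tensor fields -/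

/-- A vector field on `M` is smooth as a section of the tangent bundle. -/
def SmoothVectorField (X : Π x : M, TangentSpace I x) : Prop :=
  ContMDiff I (I.prod 𝓘(ℝ, E)) ∞ (fun x ↦ TotalSpace.mk' E (E := TangentSpace I) x (X x))

/-- A `1`-form on `M` is smooth as a section of the cotangent bundle. -/
def SmoothOneForm (η : Π x : M, TangentSpace I x →L[ℝ] ℝ) : Prop :=
  ContMDiff I (I.prod 𝓘(ℝ, E →L[ℝ] ℝ)) ∞
    (fun x ↦ TotalSpace.mk' (E →L[ℝ] ℝ) (E := fun x : M ↦ TangentSpace I x →L[ℝ] ℝ) x (η x))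

/-- A field of endomorphisms of the tangent spaces of `M` is smooth as a section of `End (TM)`. -/
def SmoothEndomorphism (N : Π x : M, TangentSpace I x →L[ℝ] TangentSpace I x) : Prop :=
  ContMDiff I (I.prod 𝓘(ℝ, E →L[ℝ] E)) ∞
    (fun x ↦ TotalSpace.mk' (E →L[ℝ] E)
      (E := fun x : M ↦ TangentSpace I x →L[ℝ] TangentSpace I x) x (N x))

theorem SmoothVectorField.mdiffAt {X : Π x : M, TangentSpace I x} (hX : SmoothVectorField X)
    (x : M) : MDiffAt (T% X) x :=
  (hX x).mdifferentiableAt (by simp)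

theorem SmoothOneForm.mdiffAt {η : Π x : M, TangentSpace I x →L[ℝ] ℝ} (hη : SmoothOneForm η)
    {x : M} {Y : Π x : M, TangentSpace I x} (hY : MDiffAt (T% Y) x) :
    MDiffAt (fun y ↦ η y (Y y)) x := by
  have h1 := (hη x).mdifferentiableAt (by simp)
  have : MDifferentiableAt I (I.prod 𝓘(ℝ))
      (fun m ↦ TotalSpace.mk' ℝ (E := Bundle.Trivial M ℝ) m (η m (Y m))) x := by
    apply MDifferentiableAt.clm_bundle_apply (F₁ := E)
    · exact h1
    · exact hY
  rw [mdifferentiableAt_totalSpace] at this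
  exact this.2

variable [FiniteDimensional ℝ E]

/-! ### Exterior derivative and covariant derivative of a `1`-form -/

/-- The value at `x` of `(1/2) (X (η Y) - Y (η X) - η [X, Y])`. -/
def extDerivAux (η : Π x : M, TangentSpace I x →L[ℝ] ℝ) (X Y : Π x : M, TangentSpace I x)
    (x : M) : ℝ :=
  (1 / 2) * (d% (fun y ↦ η y (Y y)) x (X x) - d% (fun y ↦ η y (X y)) x (Y x)
    - η x (mlieBracket I X Y x))

theorem extDerivAux_swap (η : Π x : M, TangentSpace I x →L[ℝ] ℝ) (X Y : Π x : M, TangentSpace I x)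
    (x : M) : extDerivAux η X Y x = - extDerivAux η Y X x := by
  simp only [extDerivAux]
  rw [mlieBracket_swap]
  simp only [Pi.neg_apply, map_neg]
  ring

theorem tensorial_extDerivAux₁ {η : Π x : M, TangentSpace I x →L[ℝ] ℝ} (hη : SmoothOneForm η)
    {x : M} (Y : Π x : M, TangentSpace I x) :
    TensorialAt I E (extDerivAux η · Y x) x where
  smul {f X} hf hX := by
    have h : (fun y ↦ η y ((f • X) y)) = fun y ↦ f y * η y (X y) := by ext; simp
    simp only [extDerivAux]
    rw [h, mvfderiv_fun_mul hf (hη.mdiffAt hX), mlieBracket_smul_left hf hX]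
    simp
    ring
  add {X X'} hX hX' := by
    have h : (fun y ↦ η y ((X + X') y)) = fun y ↦ η y (X y) + η y (X' y) := by ext; simp
    simp only [extDerivAux]
    rw [h, mvfderiv_fun_add (hη.mdiffAt hX) (hη.mdiffAt hX'), mlieBracket_add_left hX hX']
    simp
    ring

theorem tensorial_extDerivAux₂ {η : Π x : M, TangentSpace I x →L[ℝ] ℝ} (hη : SmoothOneForm η)
    {x : M} (X : Π x : M, TangentSpace I x) :
    TensorialAt I E (extDerivAux η X · x) x where
  smul {f Y} hf hY := by
    rw [extDerivAux_swap, (tensorial_extDerivAux₁ hη X).smul hf hY, extDerivAux_swap η X Y]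
    simp
  add {Y Y'} hY hY' := by
    rw [extDerivAux_swap, (tensorial_extDerivAux₁ hη X).add hY hY', extDerivAux_swap η X Y,
      extDerivAux_swap η X Y']
    ring

/-- The exterior derivative `dη` of a smooth `1`-form, in the normalization
`dη (X, Y) = (1/2) (X (η Y) - Y (η X) - η [X, Y])`. -/
def extDeriv (η : Π x : M, TangentSpace I x →L[ℝ] ℝ) (hη : SmoothOneForm η) (x : M) :
    TangentSpace I x →L[ℝ] TangentSpace I x →L[ℝ] ℝ :=
  TensorialAt.mkHom₂ (extDerivAux η · · x) x
    (fun Y _ ↦ tensorial_extDerivAux₁ hη Y) (fun X _ ↦ tensorial_extDerivAux₂ hη X)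

theorem extDeriv_apply {η : Π x : M, TangentSpace I x →L[ℝ] ℝ} (hη : SmoothOneForm η) {x : M}
    {X Y : Π x : M, TangentSpace I x} (hX : MDiffAt (T% X) x) (hY : MDiffAt (T% Y) x) :
    extDeriv η hη x (X x) (Y x) =
      (1 / 2) * (d% (fun y ↦ η y (Y y)) x (X x) - d% (fun y ↦ η y (X y)) x (Y x)
        - η x (mlieBracket I X Y x)) :=
  TensorialAt.mkHom₂_apply _ _ hX hY

theorem tensorial_covDerivAux (cov : CovariantDerivative I E (TangentSpace I : M → Type _))
    {η : Π x : M, TangentSpace I x →L[ℝ] ℝ} (hη : SmoothOneForm η) (x : M) :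
    TensorialAt I E (fun Y : Π x : M, TangentSpace I x ↦
      d% (fun y ↦ η y (Y y)) x - η x ∘L cov Y x) x where
  smul {f Y} hf hY := by
    have h : (fun y ↦ η y ((f • Y) y)) = fun y ↦ f y * η y (Y y) := by ext; simp
    rw [h, mvfderiv_fun_mul hf (hη.mdiffAt hY), cov.isCovariantDerivativeOn.leibniz hY hf]
    ext v
    simp
    ring
  add {Y Y'} hY hY' := by
    have h : (fun y ↦ η y ((Y + Y') y)) = fun y ↦ η y (Y y) + η y (Y' y) := by ext; simp
    rw [h, mvfderiv_fun_add (hη.mdiffAt hY) (hη.mdiffAt hY'),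
      cov.isCovariantDerivativeOn.add hY hY']
    ext v
    simp
    ring

/-- The covariant derivative of a smooth `1`-form: `covDeriv cov η hη x Y X` is
`(∇_X η) (Y) = X (η Y) - η (∇_X Y)` (the direction of differentiation is the last argument). -/
def covDeriv (cov : CovariantDerivative I E (TangentSpace I : M → Type _))
    (η : Π x : M, TangentSpace I x →L[ℝ] ℝ) (hη : SmoothOneForm η) (x : M) :
    TangentSpace I x →L[ℝ] TangentSpace I x →L[ℝ] ℝ :=
  TensorialAt.mkHom (fun Y : Π x : M, TangentSpace I x ↦
      d% (fun y ↦ η y (Y y)) x - η x ∘L cov Y x) x (tensorial_covDerivAux cov hη x)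

theorem covDeriv_apply (cov : CovariantDerivative I E (TangentSpace I : M → Type _))
    {η : Π x : M, TangentSpace I x →L[ℝ] ℝ} (hη : SmoothOneForm η) {x : M}
    {Y : Π x : M, TangentSpace I x} (hY : MDiffAt (T% Y) x) (v : TangentSpace I x) :
    covDeriv cov η hη x (Y x) v = d% (fun y ↦ η y (Y y)) x v - η x (cov Y x v) := by
  rw [covDeriv, TensorialAt.mkHom_apply _ hY]
  rfl

/-! ### Riemannian metrics -/

variable [RiemannianBundle (fun x : M ↦ TangentSpace I x)]
  [IsContMDiffRiemannianBundle I ∞ E (fun x : M ↦ TangentSpace I x)]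

/-- The endomorphism `A` of `T_x M` with `g (A u, v) = B (u, v)`, for a bilinear form `B`. -/
def endOfBilin {x : M} (B : TangentSpace I x →L[ℝ] TangentSpace I x →L[ℝ] ℝ) :
    TangentSpace I x →L[ℝ] TangentSpace I x :=
  have : FiniteDimensional ℝ (TangentSpace I x) := inferInstanceAs (FiniteDimensional ℝ E)
  have : CompleteSpace (TangentSpace I x) := FiniteDimensional.complete ℝ _
  LinearMap.toContinuousLinearMap
    { toFun := fun u ↦ (InnerProductSpace.toDual ℝ (TangentSpace I x)).symm (B u)
      map_add' := by intro u v; simp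
      map_smul' := by intro c u; simp }

theorem inner_endOfBilin {x : M} (B : TangentSpace I x →L[ℝ] TangentSpace I x →L[ℝ] ℝ)
    (u v : TangentSpace I x) : inner ℝ (endOfBilin B u) v = B u v := by
  have : FiniteDimensional ℝ (TangentSpace I x) := inferInstanceAs (FiniteDimensional ℝ E)
  have : CompleteSpace (TangentSpace I x) := FiniteDimensional.complete ℝ _
  exact InnerProductSpace.toDual_symm_apply (𝕜 := ℝ) (E := TangentSpace I x)

theorem mdiffAt_inner {x : M} {X Y : Π x : M, TangentSpace I x}
    (hX : MDiffAt (T% X) x) (hY : MDiffAt (T% Y) x) :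
    MDiffAt (fun y ↦ inner ℝ (X y) (Y y)) x :=
  MDifferentiableAt.inner_bundle (F := E) (E := fun x : M ↦ TangentSpace I x) hX hY

theorem mvfderiv_inner_smul_left {x : M} {f : M → ℝ} {X Y : Π x : M, TangentSpace I x}
    (hf : MDiffAt f x) (hX : MDiffAt (T% X) x) (hY : MDiffAt (T% Y) x) (v : TangentSpace I x) :
    d% (fun y ↦ inner ℝ ((f • X) y) (Y y)) x v =
      f x * d% (fun y ↦ inner ℝ (X y) (Y y)) x v + inner ℝ (X x) (Y x) * d% f x v := by
  have h : (fun y ↦ inner ℝ ((f • X) y) (Y y)) = fun y ↦ f y * inner ℝ (X y) (Y y) := by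
    ext; simp [inner_smul_left]
  rw [h, mvfderiv_fun_mul hf (mdiffAt_inner hX hY)]
  simp

theorem mvfderiv_inner_add_left {x : M} {X X' Y : Π x : M, TangentSpace I x}
    (hX : MDiffAt (T% X) x) (hX' : MDiffAt (T% X') x) (hY : MDiffAt (T% Y) x)
    (v : TangentSpace I x) :
    d% (fun y ↦ inner ℝ ((X + X') y) (Y y)) x v =
      d% (fun y ↦ inner ℝ (X y) (Y y)) x v + d% (fun y ↦ inner ℝ (X' y) (Y y)) x v := by
  have h : (fun y ↦ inner ℝ ((X + X') y) (Y y)) =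
      fun y ↦ inner ℝ (X y) (Y y) + inner ℝ (X' y) (Y y) := by
    ext; simp [inner_add_left]
  rw [h, mvfderiv_fun_add (mdiffAt_inner hX hY) (mdiffAt_inner hX' hY)]
  simp

theorem inner_field_comm (X Y : Π x : M, TangentSpace I x) :
    (fun y ↦ inner ℝ (X y) (Y y)) = fun y ↦ inner ℝ (Y y) (X y) := by
  ext; exact real_inner_comm _ _

/-! ### The Lie derivative of the metric -/

/-- The value at `x` of `ξ (g (X, Y)) - g ([ξ, X], Y) - g (X, [ξ, Y])`. -/
def lieMetricAux (ξ X Y : Π x : M, TangentSpace I x) (x : M) : ℝ :=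
  d% (fun y ↦ inner ℝ (X y) (Y y)) x (ξ x) - inner ℝ (mlieBracket I ξ X x) (Y x)
    - inner ℝ (X x) (mlieBracket I ξ Y x)

theorem lieMetricAux_comm (ξ X Y : Π x : M, TangentSpace I x) (x : M) :
    lieMetricAux ξ X Y x = lieMetricAux ξ Y X x := by
  have h : (fun y ↦ inner ℝ (X y) (Y y)) = fun y ↦ inner ℝ (Y y) (X y) := by
    ext; exact real_inner_comm _ _
  simp only [lieMetricAux]
  rw [h, real_inner_comm (mlieBracket I ξ X x), real_inner_comm (X x)]
  ring

theorem tensorial_lieMetricAux {ξ : Π x : M, TangentSpace I x} {x : M}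
    {Y : Π x : M, TangentSpace I x} (hY : MDiffAt (T% Y) x) :
    TensorialAt I E (lieMetricAux ξ · Y x) x where
  smul {f X} hf hX := by
    simp only [lieMetricAux]
    rw [mvfderiv_inner_smul_left hf hX hY, mlieBracket_smul_right hf hX]
    simp [inner_add_left, inner_smul_left]
    ring
  add {X X'} hX hX' := by
    simp only [lieMetricAux]
    rw [mvfderiv_inner_add_left hX hX' hY, mlieBracket_add_right hX hX']
    simp [inner_add_left]
    ring

/-- The Lie derivative of the metric,
`(L_ξ g) (X, Y) = ξ (g (X, Y)) - g ([ξ, X], Y) - g (X, [ξ, Y])`. -/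
def lieMetric (ξ : Π x : M, TangentSpace I x) (x : M) :
    TangentSpace I x →L[ℝ] TangentSpace I x →L[ℝ] ℝ :=
  TensorialAt.mkHom₂ (lieMetricAux ξ · · x) x
    (fun _ hY ↦ tensorial_lieMetricAux hY)
    (fun X hX ↦ by
      have : (fun Y ↦ lieMetricAux ξ X Y x) = fun Y ↦ lieMetricAux ξ Y X x := by
        ext Y; exact lieMetricAux_comm ξ X Y x
      rw [this]
      exact tensorial_lieMetricAux hX)

theorem lieMetric_apply {ξ : Π x : M, TangentSpace I x} {x : M}
    {X Y : Π x : M, TangentSpace I x} (hX : MDiffAt (T% X) x) (hY : MDiffAt (T% Y) x) :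
    lieMetric ξ x (X x) (Y x) =
      d% (fun y ↦ inner ℝ (X y) (Y y)) x (ξ x) - inner ℝ (mlieBracket I ξ X x) (Y x)
        - inner ℝ (X x) (mlieBracket I ξ Y x) :=
  TensorialAt.mkHom₂_apply _ _ hX hY

/-! ### The Levi-Civita connection -/

/-- The right-hand side of the Koszul formula for `2 g (∇_X Y, Z)` at `x`. -/
def koszul (Y X Z : Π x : M, TangentSpace I x) (x : M) : ℝ :=
  d% (fun y ↦ inner ℝ (Y y) (Z y)) x (X x) + d% (fun y ↦ inner ℝ (X y) (Z y)) x (Y x)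
    - d% (fun y ↦ inner ℝ (X y) (Y y)) x (Z x)
    + inner ℝ (mlieBracket I X Y x) (Z x) - inner ℝ (mlieBracket I X Z x) (Y x)
    - inner ℝ (mlieBracket I Y Z x) (X x)

theorem tensorial_koszul₁ {x : M} {Y Z : Π x : M, TangentSpace I x}
    (hY : MDiffAt (T% Y) x) (hZ : MDiffAt (T% Z) x) :
    TensorialAt I E (koszul Y · Z x) x where
  smul {f X} hf hX := by
    simp only [koszul]
    rw [mvfderiv_inner_smul_left hf hX hZ, mvfderiv_inner_smul_left hf hX hY,
      mlieBracket_smul_left hf hX, mlieBracket_smul_left hf hX]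
    simp [inner_add_left, inner_smul_left, inner_smul_right]
    ring
  add {X X'} hX hX' := by
    simp only [koszul]
    rw [mvfderiv_inner_add_left hX hX' hZ, mvfderiv_inner_add_left hX hX' hY,
      mlieBracket_add_left hX hX', mlieBracket_add_left hX hX']
    simp [inner_add_left, inner_add_right]
    ring

theorem tensorial_koszul₂ {x : M} {Y X : Π x : M, TangentSpace I x}
    (hY : MDiffAt (T% Y) x) (hX : MDiffAt (T% X) x) :
    TensorialAt I E (koszul Y X · x) x where
  smul {f Z} hf hZ := by
    simp only [koszul]
    rw [inner_field_comm Y (f • Z), inner_field_comm X (f • Z),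
      mvfderiv_inner_smul_left hf hZ hX, mvfderiv_inner_smul_left hf hZ hY,
      mlieBracket_smul_right hf hZ, mlieBracket_smul_right hf hZ,
      inner_field_comm Z X, inner_field_comm Z Y]
    simp [inner_add_left, inner_smul_left, inner_smul_right]
    ring
  add {Z Z'} hZ hZ' := by
    simp only [koszul]
    rw [inner_field_comm Y (Z + Z'), inner_field_comm X (Z + Z'),
      mvfderiv_inner_add_left hZ hZ' hX, mvfderiv_inner_add_left hZ hZ' hY,
      mlieBracket_add_right hZ hZ', mlieBracket_add_right hZ hZ',
      inner_field_comm Z X, inner_field_comm Z Y, inner_field_comm Z' X, inner_field_comm Z' Y]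
    simp [inner_add_left, inner_add_right]
    ring

open Classical in
/-- The Levi-Civita derivative `X ↦ ∇_X Y` at `x`, defined by the Koszul formula when `Y` is
differentiable at `x` (and `0` otherwise). -/
def leviCivitaAux (Y : Π x : M, TangentSpace I x) (x : M) :
    TangentSpace I x →L[ℝ] TangentSpace I x :=
  if hY : MDiffAt (T% Y) x then
    endOfBilin ((1 / 2 : ℝ) • TensorialAt.mkHom₂ (koszul Y · · x) x
      (fun _ hZ ↦ tensorial_koszul₁ hY hZ) (fun _ hX ↦ tensorial_koszul₂ hY hX))
  else 0

theorem inner_leviCivitaAux {x : M} {X Y Z : Π x : M, TangentSpace I x}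
    (hY : MDiffAt (T% Y) x) (hX : MDiffAt (T% X) x) (hZ : MDiffAt (T% Z) x) :
    inner ℝ (leviCivitaAux Y x (X x)) (Z x) = (1 / 2) * koszul Y X Z x := by
  rw [leviCivitaAux, dif_pos hY, inner_endOfBilin]
  simp only [smul_apply, smul_eq_mul]
  rw [TensorialAt.mkHom₂_apply _ _ hX hZ]

theorem leviCivitaAux_add {x : M} {Y Y' : Π x : M, TangentSpace I x}
    (hY : MDiffAt (T% Y) x) (hY' : MDiffAt (T% Y') x) :
    leviCivitaAux (Y + Y') x = leviCivitaAux Y x + leviCivitaAux Y' x := by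
  ext v
  refine ext_inner_right ℝ fun w ↦ ?_
  have hv := mdifferentiableAt_extend I E v
  have hw := mdifferentiableAt_extend I E w
  have e := inner_leviCivitaAux (mdifferentiableAt_add_section hY hY') hv hw
  have e1 := inner_leviCivitaAux hY hv hw
  have e2 := inner_leviCivitaAux hY' hv hw
  simp only [koszul] at e e1 e2
  rw [inner_field_comm (extend E v) (Y + Y'), mvfderiv_inner_add_left hY hY' hw,
    mvfderiv_inner_add_left hY hY' hv, mlieBracket_add_right hY hY',
    mlieBracket_add_left hY hY', inner_field_comm Y (extend E v),
    inner_field_comm Y' (extend E v)] at e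
  simp only [extend_apply_self, Pi.add_apply, map_add, inner_add_left, inner_add_right] at e e1 e2
  rw [add_apply, inner_add_left, e, e1, e2]
  ring

theorem leviCivitaAux_smul {x : M} {Y : Π x : M, TangentSpace I x} {f : M → ℝ}
    (hY : MDiffAt (T% Y) x) (hf : MDiffAt f x) :
    leviCivitaAux (f • Y) x = f x • leviCivitaAux Y x + (d% f x).smulRight (Y x) := by
  ext v
  refine ext_inner_right ℝ fun w ↦ ?_
  have hv := mdifferentiableAt_extend I E v
  have hw := mdifferentiableAt_extend I E w
  have e := inner_leviCivitaAux (hf.smul_section hY) hv hw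
  have e1 := inner_leviCivitaAux hY hv hw
  simp only [koszul] at e e1
  rw [inner_field_comm (extend E v) (f • Y), mvfderiv_inner_smul_left hf hY hw,
    mvfderiv_inner_smul_left hf hY hv, mlieBracket_smul_right hf hY,
    mlieBracket_smul_left hf hY, inner_field_comm Y (extend E v)] at e
  simp only [extend_apply_self, Pi.smul_apply', map_smul, inner_add_left, inner_smul_left,
    inner_smul_right, smul_eq_mul, conj_trivial] at e e1
  rw [add_apply, smul_apply, inner_add_left, inner_smul_left, e, e1]
  simp [inner_smul_left]
  rw [real_inner_comm v (Y x)]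
  ring

variable (I M) in
/-- The Levi-Civita connection of the Riemannian metric of `M`. -/
def leviCivita : CovariantDerivative I E (TangentSpace I : M → Type _) where
  toFun := leviCivitaAux
  isCovariantDerivativeOnUniv :=
  { add := fun hY hY' _ ↦ leviCivitaAux_add hY hY'
    leibniz := fun hY hf _ ↦ leviCivitaAux_smul hY hf }

theorem inner_leviCivita {x : M} {X Y Z : Π x : M, TangentSpace I x}
    (hX : MDiffAt (T% X) x) (hY : MDiffAt (T% Y) x) (hZ : MDiffAt (T% Z) x) :
    inner ℝ (leviCivita I M Y x (X x)) (Z x) = (1 / 2) * koszul Y X Z x :=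
  inner_leviCivitaAux hY hX hZ

theorem torsion_leviCivita : (leviCivita I M).torsion = 0 := by
  rw [CovariantDerivative.torsion_eq_zero_iff]
  intro X Y x hX hY
  refine ext_inner_right ℝ fun w ↦ ?_
  have hw := mdifferentiableAt_extend I E w
  have e1 := inner_leviCivita hX hY hw
  have e2 := inner_leviCivita hY hX hw
  simp only [koszul, extend_apply_self] at e1 e2
  rw [inner_sub_left, e1, e2, mlieBracket_swap (V := Y) (W := X), inner_field_comm Y X]
  simp only [Pi.neg_apply, inner_neg_left]
  ring

theorem leviCivita_metric {x : M} {X Y Z : Π x : M, TangentSpace I x}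
    (hX : MDiffAt (T% X) x) (hY : MDiffAt (T% Y) x) (hZ : MDiffAt (T% Z) x) :
    d% (fun y ↦ inner ℝ (Y y) (Z y)) x (X x) =
      inner ℝ (leviCivita I M Y x (X x)) (Z x) + inner ℝ (Y x) (leviCivita I M Z x (X x)) := by
  have e1 := inner_leviCivita hX hY hZ
  have e2 := inner_leviCivita hX hZ hY
  simp only [koszul] at e1 e2
  rw [real_inner_comm (leviCivita I M Z x (X x)), e1, e2, mlieBracket_swap (V := Z) (W := Y),
    inner_field_comm Z Y]
  simp only [Pi.neg_apply, inner_neg_left]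
  ring

/-! ### Sub-Riemannian structures of contact type -/

variable (I M) in
/-- A sub-Riemannian structure of contact type on a Riemannian manifold `M`: a smooth unit vector
field `ξ` and a smooth `1`-form `η`, normalized by `η ξ = 1`, such that the distribution
`D = ker η` is orthogonal to the distribution spanned by `ξ`. -/
structure ContactType where
  ξ : Π x : M, TangentSpace I x
  η : Π x : M, TangentSpace I x →L[ℝ] ℝ
  smooth_ξ : SmoothVectorField ξ
  smooth_η : SmoothOneForm η
  inner_ξ_ξ : ∀ x, inner ℝ (ξ x) (ξ x) = 1
  η_ξ : ∀ x, η x (ξ x) = 1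
  orthogonal : ∀ x (v : TangentSpace I x), η x v = 0 → inner ℝ v (ξ x) = 0

namespace ContactType

variable (S : ContactType I M)

/-- The distribution `D = ker η`. -/
def D (x : M) : Submodule ℝ (TangentSpace I x) := LinearMap.ker (S.η x : _ →ₗ[ℝ] ℝ)

/-- The projector `P : TM → D` along `ξ`. -/
def P (x : M) : TangentSpace I x →L[ℝ] TangentSpace I x :=
  ContinuousLinearMap.id ℝ _ - (S.η x).smulRight (S.ξ x)

/-- The form `ω = dη` (written `dη` in Lean, as `ω` is a reserved symbol). -/
def dη (x : M) : TangentSpace I x →L[ℝ] TangentSpace I x →L[ℝ] ℝ :=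
  extDeriv S.η S.smooth_η x

/-- The admissible endomorphism `ψ`: it kills `ξ`, maps `D` to `D`, and
`g (ψ X, Y) = ω (X, Y)` for `X`, `Y` in `D`. -/
def ψ (x : M) : TangentSpace I x →L[ℝ] TangentSpace I x :=
  endOfBilin ((S.dη x).bilinearComp (S.P x) (S.P x))

/-- The admissible endomorphism `C`: it kills `ξ`, maps `D` to `D`, and
`g (C X, Y) = (1/2) (L_ξ g) (X, Y)` for `X`, `Y` in `D`. -/
def C (x : M) : TangentSpace I x →L[ℝ] TangentSpace I x :=
  endOfBilin ((1 / 2 : ℝ) • (lieMetric S.ξ x).bilinearComp (S.P x) (S.P x))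

/-- For a field of endomorphisms `N`, the `N`-connection
`∇^N_X Y = ∇_X Y + (∇_X η) (Y) ξ - η (Y) ∇_X ξ - η (X) (∇_ξ η) (Y) ξ - η (X) (C + ψ - N) Y`,
where `∇` is the Levi-Civita connection. -/
def nConnection (N : Π x : M, TangentSpace I x →L[ℝ] TangentSpace I x) :
    CovariantDerivative I E (TangentSpace I : M → Type _) where
  toFun := fun Y x ↦ leviCivita I M Y x
    + (covDeriv (leviCivita I M) S.η S.smooth_η x (Y x)).smulRight (S.ξ x)
    - S.η x (Y x) • leviCivita I M S.ξ x
    - (S.η x).smulRight (covDeriv (leviCivita I M) S.η S.smooth_η x (Y x) (S.ξ x) • S.ξ x)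
    - (S.η x).smulRight ((S.C x + S.ψ x - N x) (Y x))
  isCovariantDerivativeOnUniv :=
  { add := by
      intro Y Y' x hY hY' _
      rw [(leviCivita I M).isCovariantDerivativeOn.add hY hY']
      ext v
      simp
      module
    leibniz := by
      intro Y f x hY hf _
      rw [(leviCivita I M).isCovariantDerivativeOn.leibniz hY hf]
      ext v
      simp
      module }

theorem nConnection_apply (N : Π x : M, TangentSpace I x →L[ℝ] TangentSpace I x)
    (X Y : Π x : M, TangentSpace I x) (x : M) :
    S.nConnection N Y x (X x) = leviCivita I M Y x (X x)
      + covDeriv (leviCivita I M) S.η S.smooth_η x (Y x) (X x) • S.ξ x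
      - S.η x (Y x) • leviCivita I M S.ξ x (X x)
      - (S.η x (X x) * covDeriv (leviCivita I M) S.η S.smooth_η x (Y x) (S.ξ x)) • S.ξ x
      - S.η x (X x) • (S.C x (Y x) + S.ψ x (Y x) - N x (Y x)) := by
  rw [mul_smul]
  rfl

end ContactType

/-- A connection on the tangent bundle has skew-symmetric torsion `S` if the trilinear form
`(X, Y, Z) ↦ g (S (X, Y), Z)` is skew-symmetric in all its arguments. -/
def HasSkewTorsion (cov : CovariantDerivative I E (TangentSpace I : M → Type _)) : Prop :=
  ∀ (x : M) (X Y Z : TangentSpace I x),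
    inner ℝ (cov.torsion x X Y) Z = - inner ℝ (cov.torsion x Y X) Z ∧
    inner ℝ (cov.torsion x X Y) Z = - inner ℝ (cov.torsion x X Z) Y ∧
    inner ℝ (cov.torsion x X Y) Z = - inner ℝ (cov.torsion x Z Y) X

end SubRiem

end

set_option linter.unusedSectionVars false

namespace SubRiem

variable {E : Type*} [NormedAddCommGroup E] [NormedSpace ℝ E]
  {H : Type*} [TopologicalSpace H] {I : ModelWithCorners ℝ E H}
  {M : Type*} [TopologicalSpace M] [ChartedSpace H M] [IsManifold I ∞ M]
  [FiniteDimensional ℝ E] [RiemannianBundle (fun x : M ↦ TangentSpace I x)]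
  [IsContMDiffRiemannianBundle I ∞ E (fun x : M ↦ TangentSpace I x)]

/-! Everything reduces to the single tensor `∇ξ`, with `∇` the Levi-Civita connection. Since `η = g
(·, ξ)`, metric compatibility gives `(∇_u η) (v) = g (v, ∇_u ξ)`, and `|ξ| = 1` puts the image of
`∇ξ` in `D`. On `D`, `C` and `ψ` are the symmetric and skew parts of `∇ξ`, so `C + ψ` is `∇ξ`
composed with the projector `P` (`C_add_ψ`). Substituting this into the connection, all terms in
`∇_ξ ξ` cancel and the torsion depends only on `ψ`, `η`, `ξ` and `N` (`torsion_nConnection`).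
Lowering an index gives `2 g (ψ u, v) η (w) + η (u) g (N v, w) - η (v) g (N u, w)`. Exchanging the
last two arguments at `(u, ξ, w)` forces `g (N u, w) = 2 g (ψ u, w)`. Conversely, for `N = 2ψ` the
form is twice the cyclic sum of `g (ψ u, v) η (w)`, which alternates because `ψ` is skew. -/

theorem mlieBracket_eq_leviCivita {x : M} {X Y : Π x : M, TangentSpace I x}
    (hX : MDiffAt (T% X) x) (hY : MDiffAt (T% Y) x) :
    mlieBracket I X Y x = leviCivita I M Y x (X x) - leviCivita I M X x (Y x) :=
  ((CovariantDerivative.torsion_eq_zero_iff _).1 torsion_leviCivita hX hY).symm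

/-- `(L_ξ g) (u, v) = g (∇_u ξ, v) + g (u, ∇_v ξ)`. -/
theorem lieMetric_eq_leviCivita {ξ : Π x : M, TangentSpace I x} {x : M}
    (hξ : MDiffAt (T% ξ) x) (u v : TangentSpace I x) :
    lieMetric ξ x u v = inner ℝ (leviCivita I M ξ x u) v + inner ℝ u (leviCivita I M ξ x v) := by
  -- Both sides are tensorial, so any fields through `u` and `v` that are differentiable at `x` will
  -- do.
  have hu := mdifferentiableAt_extend I E u
  have hv := mdifferentiableAt_extend I E v
  have e := lieMetric_apply (ξ := ξ) hu hv
  rw [leviCivita_metric hξ hu hv, mlieBracket_eq_leviCivita hξ hu,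
    mlieBracket_eq_leviCivita hξ hv] at e
  simp only [extend_apply_self, inner_sub_left, inner_sub_right] at e
  rw [e]
  ring

/-- `2 dη (u, v) = (∇_u η) (v) - (∇_v η) (u)` for the Levi-Civita connection. -/
theorem extDeriv_eq_covDeriv {η : Π x : M, TangentSpace I x →L[ℝ] ℝ} (hη : SmoothOneForm η)
    {x : M} (u v : TangentSpace I x) :
    extDeriv η hη x u v = (1 / 2) * (covDeriv (leviCivita I M) η hη x v u
      - covDeriv (leviCivita I M) η hη x u v) := by
  have hu := mdifferentiableAt_extend I E u
  have hv := mdifferentiableAt_extend I E v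
  have e := extDeriv_apply hη hu hv
  have e1 := covDeriv_apply (leviCivita I M) hη hu v
  have e2 := covDeriv_apply (leviCivita I M) hη hv u
  rw [mlieBracket_eq_leviCivita hu hv] at e
  simp only [extend_apply_self, map_sub] at e e1 e2
  rw [e, e1, e2]
  ring

namespace ContactType

variable (S : ContactType I M)

/-! ### The unit field `ξ`, its dual form `η`, and `∇ξ`. -/

theorem P_apply (x : M) (v : TangentSpace I x) : S.P x v = v - S.η x v • S.ξ x := rfl

theorem η_P (x : M) (v : TangentSpace I x) : S.η x (S.P x v) = 0 := by
  simp [P_apply, S.η_ξ]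

theorem P_ξ (x : M) : S.P x (S.ξ x) = 0 := by
  simp [P_apply, S.η_ξ]

/-- Both forms vanish on `D` and equal `1` on `ξ`. -/
theorem inner_ξ (x : M) (v : TangentSpace I x) : inner ℝ v (S.ξ x) = S.η x v := by
  have h := S.orthogonal x _ (S.η_P x v)
  rw [P_apply, inner_sub_left, real_inner_smul_left, S.inner_ξ_ξ] at h
  linarith

/-- Differentiate `g (ξ, ξ) = 1` along `u`. -/
theorem inner_leviCivita_ξ_ξ (x : M) (u : TangentSpace I x) :
    inner ℝ (leviCivita I M S.ξ x u) (S.ξ x) = 0 := by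
  have hξ := S.smooth_ξ.mdiffAt x
  have e := leviCivita_metric (mdifferentiableAt_extend I E u) hξ hξ
  simp only [S.inner_ξ_ξ, extend_apply_self, mvfderiv_const] at e
  rw [real_inner_comm (leviCivita I M S.ξ x u)] at e
  simp only [zero_apply] at e
  linarith

theorem η_leviCivita_ξ (x : M) (u : TangentSpace I x) :
    S.η x (leviCivita I M S.ξ x u) = 0 := by
  rw [← S.inner_ξ, S.inner_leviCivita_ξ_ξ]

/-- `(∇_u η) (v) = g (v, ∇_u ξ)`. -/
theorem covDeriv_η (x : M) (u v : TangentSpace I x) :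
    covDeriv (leviCivita I M) S.η S.smooth_η x v u = inner ℝ v (leviCivita I M S.ξ x u) := by
  have hξ := S.smooth_ξ.mdiffAt x
  have hu := mdifferentiableAt_extend I E u
  have hv := mdifferentiableAt_extend I E v
  have e := covDeriv_apply (leviCivita I M) S.smooth_η hv u
  have e' := leviCivita_metric hu hv hξ
  -- Reading `g (Y, ξ)` as `η (Y)` makes the same derivative appear in `e` and `e'`.
  simp only [S.inner_ξ, extend_apply_self] at e e'
  rw [e, e']
  ring

theorem dη_apply (x : M) (u v : TangentSpace I x) :
    S.dη x u v = (1 / 2) * (inner ℝ v (leviCivita I M S.ξ x u)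
      - inner ℝ u (leviCivita I M S.ξ x v)) := by
  rw [dη, extDeriv_eq_covDeriv, covDeriv_η, covDeriv_η]

/-! ### The endomorphisms `ψ` and `C` as parts of `∇ξ`. -/

theorem inner_ψ (x : M) (u v : TangentSpace I x) :
    inner ℝ (S.ψ x u) v = S.dη x (S.P x u) (S.P x v) :=
  inner_endOfBilin _ u v

theorem inner_C (x : M) (u v : TangentSpace I x) :
    inner ℝ (S.C x u) v = (1 / 2) * lieMetric S.ξ x (S.P x u) (S.P x v) :=
  inner_endOfBilin _ u v

theorem inner_ψ_swap (x : M) (u v : TangentSpace I x) :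
    inner ℝ (S.ψ x u) v = - inner ℝ (S.ψ x v) u := by
  rw [inner_ψ, inner_ψ, dη_apply, dη_apply]
  ring

theorem inner_ψ_ξ (x : M) (u : TangentSpace I x) : inner ℝ (S.ψ x u) (S.ξ x) = 0 := by
  rw [inner_ψ, P_ξ, map_zero]

/-- `C + ψ` is the covariant derivative of `ξ` along the projection to `D`. -/
theorem C_add_ψ (x : M) (u : TangentSpace I x) :
    S.C x u + S.ψ x u = leviCivita I M S.ξ x (S.P x u) := by
  refine ext_inner_right ℝ fun w ↦ ?_
  -- `C` and `ψ` see only `P w`; nothing is lost, as `∇ξ` has no `ξ`-component.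
  have hw : inner ℝ (leviCivita I M S.ξ x (S.P x u)) w
      = inner ℝ (leviCivita I M S.ξ x (S.P x u)) (S.P x w) := by
    rw [P_apply S x w, inner_sub_right, real_inner_smul_right, S.inner_leviCivita_ξ_ξ]
    ring
  rw [inner_add_left, inner_C, inner_ψ, dη_apply, lieMetric_eq_leviCivita (S.smooth_ξ.mdiffAt x),
    hw, real_inner_comm (S.P x w) (leviCivita I M S.ξ x (S.P x u))]
  ring

/-! ### The torsion and its skew-symmetry. -/

/-- The torsion of the `N`-connection is `2 ω (P u, P v) ξ + η (u) N v - η (v) N u`. -/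
theorem torsion_nConnection (N : Π x : M, TangentSpace I x →L[ℝ] TangentSpace I x) (x : M)
    (u v : TangentSpace I x) :
    (S.nConnection N).torsion x u v =
      (2 * inner ℝ (S.ψ x u) v) • S.ξ x + S.η x u • N x v - S.η x v • N x u := by
  have hu := mdifferentiableAt_extend I E u
  have hv := mdifferentiableAt_extend I E v
  have e := CovariantDerivative.torsion_apply (S.nConnection N) hu hv
  rw [nConnection_apply, nConnection_apply, mlieBracket_eq_leviCivita hu hv] at e
  simp only [extend_apply_self, C_add_ψ, covDeriv_η] at e
  rw [e, inner_ψ, dη_apply]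
  -- Expanding `P` splits off multiples of `∇_ξ ξ`. Those from `C + ψ` combine with `η (v) ∇_u ξ`
  -- and `η (u) ∇_v ξ` and cancel by symmetry; those from `ω (P u, P v)` match the `(∇_ξ η)` terms.
  simp only [P_apply, map_sub, map_smul, inner_sub_left, inner_sub_right, real_inner_smul_left,
    real_inner_smul_right, real_inner_comm _ (S.ξ x), inner_ξ, η_leviCivita_ξ]
  module

theorem hasSkewTorsion_nConnection_iff
    (N : Π x : M, TangentSpace I x →L[ℝ] TangentSpace I x)
    (hNξ : ∀ x, N x (S.ξ x) = 0) (hND : ∀ x, ∀ v ∈ S.D x, N x v ∈ S.D x) :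
    HasSkewTorsion (S.nConnection N) ↔ ∀ x, N x = (2 : ℝ) • S.ψ x := by
  have inner_torsion (x : M) (u v w : TangentSpace I x) :
      inner ℝ ((S.nConnection N).torsion x u v) w =
        2 * inner ℝ (S.ψ x u) v * S.η x w + S.η x u * inner ℝ (N x v) w
          - S.η x v * inner ℝ (N x u) w := by
    rw [torsion_nConnection, inner_sub_left, inner_add_left, real_inner_smul_left,
      real_inner_smul_left, real_inner_smul_left, real_inner_comm w, S.inner_ξ]
  constructor
  · intro h x
    -- `N` takes every vector into `D`, since it preserves `D` and kills the complement `ξ`.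
    have η_N (u : TangentSpace I x) : S.η x (N x u) = 0 := by
      have hu : S.P x u ∈ S.D x := S.η_P x u
      have h0 : S.η x (N x (S.P x u)) = 0 := hND x _ hu
      simpa [P_apply, hNξ] using h0
    ext u
    refine ext_inner_right ℝ fun w ↦ ?_
    -- At `(u, ξ, w)` only `-g (N u, w)` survives, and at `(u, w, ξ)` only `2 g (ψ u, w)`.
    have e := (h x u (S.ξ x) w).2.1
    rw [inner_torsion, inner_torsion, S.inner_ψ_ξ, hNξ, S.inner_ξ, S.inner_ξ, η_N, η_N, S.η_ξ,
      inner_zero_left] at e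
    rw [smul_apply, real_inner_smul_left]
    linarith
  · intro h x u v w
    simp only [inner_torsion, h, smul_apply, real_inner_smul_left]
    -- Fixing one order of arguments for each pair in `ψ` turns the three identities into polynomial
    -- ones.
    rw [S.inner_ψ_swap x v u, S.inner_ψ_swap x w u, S.inner_ψ_swap x w v]
    refine ⟨?_, ?_, ?_⟩ <;> ring

end ContactType

end SubRiem

theorem proposition2 {m : ℕ}
    {E : Type*} [NormedAddCommGroup E] [NormedSpace ℝ E] [FiniteDimensional ℝ E]
    (hdim : Module.finrank ℝ E = 2 * m + 1)
    {M : Type*} [TopologicalSpace M] [ChartedSpace E M] [IsManifold 𝓘(ℝ, E) ∞ M]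
    [RiemannianBundle (fun x : M ↦ TangentSpace 𝓘(ℝ, E) x)]
    [IsContMDiffRiemannianBundle 𝓘(ℝ, E) ∞ E (fun x : M ↦ TangentSpace 𝓘(ℝ, E) x)]
    (S : SubRiem.ContactType 𝓘(ℝ, E) M)
    (N : Π x : M, TangentSpace 𝓘(ℝ, E) x →L[ℝ] TangentSpace 𝓘(ℝ, E) x)
    (hN : SubRiem.SmoothEndomorphism N)
    (hNξ : ∀ x, N x (S.ξ x) = 0)
    (hND : ∀ x, ∀ v ∈ S.D x, N x v ∈ S.D x) :
    SubRiem.HasSkewTorsion (S.nConnection N) ↔ ∀ x, N x = (2 : ℝ) • S.ψ x :=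
  S.hasSkewTorsion_nConnection_iff N hNξ hND
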